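/- Let $\Omega$ be a set and $\mathscr H$ a linear space of real functions on $\Omega$ such that $\varphi(X_1,\dots,X_n)\in\mathscr H$ whenever $X_1,\dots,X_n\in\mathscr H$ and $\varphi\in C_b(\mathbb R^n)\cup C_{l,Lip}(\mathbb R^n)$. Here $C_b$ denotes the bounded continuous functions and $C_{l,Lip}$ the functions with $|\varphi(x)-\varphi(y)|\le C(1+|x|^m+|y|^m)|x-y|$ for all $x,y$, for some $C>0$ and $m\in\mathbb N$ depending on $\varphi$. Let $\hat{\mathbb E}:\mathscr H\to[-\infty,\infty]$ be a sub-linear expectation, i.e. for $X,Y\in\mathscr H$: $\hat{\mathbb E}[X]\ge\hat{\mathbb E}[Y]$ if $X\ge Y$; $\hat{\mathbb E}[c]=c$ for constants $c\in\mathbb R$; $\hat{\mathbb E}[X+Y]\le\hat{\mathbb E}[X]+\hat{\mathbb E}[Y]$ whenever the right side is not of the form $\infty-\infty$ or $-\infty+\infty$; $\hat{\mathbb E}[\lambda X]=\lambda\hat{\mathbb E}[X]$ for $\lambda\ge0$. Let $\mathbb V(A)=\inf\{\hat{\mathbb E}[\xi]: 1_A\le\xi,\ \xi\in\mathscr H\}$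 be the associated upper capacity. Let $X_1,X_2,\dots\in\mathscr H$ be independent and identically distributed in the following sense. * For every $i$ and every $\varphi\in C_{l,Lip}(\mathbb R)$, $\hat{\mathbb E}[\varphi(X_i)]=\hat{\mathbb E}[\varphi(X_1)]$ whenever both are finite. * For every $i\ge1$, with $\mathbf X=(X_1,\dots,X_i)$ and $Y=X_{i+1}$, and every $\varphi\in C_{l,Lip}(\mathbb R^i\times\mathbb R)$, one has $\hat{\mathbb E}[\varphi(\mathbf X,Y)]=\hat{\mathbb E}\big[\hat{\mathbb E}[\varphi(x,Y)]\big|_{x=\mathbf X}\big]$ whenever $\bar\varphi(x):=\hat{\mathbb E}[|\varphi(x,Y)|]<\infty$ for all $x$ and $\hat{\mathbb E}[|\bar\varphi(\mathbf X)|]<\infty$ (the arguments of the outer expectations being members of $\mathscr H$). Suppose $\hat{\mathbb E}[X_1]=-\hat{\mathbb E}[-X_1]=0$, and $\hat{\mathbb E}[X_1^2]=\overline\sigma^2$, $-\hat{\mathbb E}[-X_1^2]=\underline\sigma^2$ with $0\le\underline\sigma\le\overline\sigma<\infty$. Put $S_0=0$, $S_k=X_1+\dots+X_k$, and for $n\ge1$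 let $W_n$ be the random element of $C[0,1]$ (with the supremum norm) with $W_n(k/n)=S_k/\sqrt n$ for $k=0,\dots,n$ and linear interpolation on each interval $[(k-1)/n,k/n]$. Write $\omega_\delta(x)=\sup\{|x(t)-x(s)|: s,t\in[0,1],\ |t-s|<\delta\}$ for $x\in C[0,1]$. Theorem. Suppose $\hat{\mathbb E}[(X_1^2-b)^+]\to0$ as $b\to\infty$. Then: (a) for every $\epsilon>0$, $\displaystyle\lim_{\delta\downarrow0}\ \sup_{n\ge1}\mathbb V\big(\omega_\delta(W_n)\ge\epsilon\big)=0$; (b) for every $\eta>0$ there is a compact set $K\subset C[0,1]$ such that $\displaystyle\sup_{n\ge1}\mathbb V\big(W_n\notin K\big)<\eta$. -/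

import Mathlib

open Filter Topology

/-- `φ ∈ C_b(V)`: bounded continuous test functions. -/
def IsBddCont {V : Type*} [NormedAddCommGroup V] (φ : V → ℝ) : Prop :=
  Continuous φ ∧ ∃ M : ℝ, ∀ x, |φ x| ≤ M

/-- `φ ∈ C_{l,Lip}(V)`: locally Lipschitz functions with polynomial growth of the local
Lipschitz constant.  It is used for `V = Fin n → ℝ` and products of such spaces; the class does
not depend on which of the equivalent norms is taken. -/
def IsLocLip {V : Type*} [NormedAddCommGroup V] (φ : V → ℝ) : Prop :=
  ∃ C : ℝ, 0 < C ∧ ∃ m : ℕ, ∀ x y : V, |φ x - φ y| ≤ C * (1 + ‖x‖ ^ m + ‖y‖ ^ m) * ‖x - y‖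

/-- A sub-linear expectation space `(Ω, H, E)`.  The functional `E` is only meaningful on `H`:
all laws are required on `H` only, and it is only ever evaluated on members of `H`. -/
structure SubLinearExpSpace (Ω : Type*) where
  /-- the linear space of random variables -/
  H : Submodule ℝ (Ω → ℝ)
  comp_mem : ∀ (n : ℕ) (X : Fin n → Ω → ℝ), (∀ i, X i ∈ H) →
    ∀ φ : (Fin n → ℝ) → ℝ, (IsBddCont φ ∨ IsLocLip φ) → (fun ω => φ (fun i => X i ω)) ∈ H
  /-- the sub-linear expectation, with values in `[-∞, ∞]` -/
  E : (Ω → ℝ) → EReal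
  mono : ∀ X ∈ H, ∀ Y ∈ H, (∀ ω, Y ω ≤ X ω) → E Y ≤ E X
  const : ∀ c : ℝ, E (fun _ => c) = (c : EReal)
  subadd : ∀ X ∈ H, ∀ Y ∈ H, ¬ (E X = ⊤ ∧ E Y = ⊥) → ¬ (E X = ⊥ ∧ E Y = ⊤) →
    E (X + Y) ≤ E X + E Y
  pos_homog : ∀ X ∈ H, ∀ c : ℝ, 0 ≤ c → E (c • X) = (c : EReal) * E X

namespace SubLinearExpSpace

variable {Ω : Type*} {Ω' : Type*}

/-- The conjugate expectation `X ↦ -E[-X]`. -/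
noncomputable def conj (S : SubLinearExpSpace Ω) (X : Ω → ℝ) : EReal := - S.E (-X)

/-- The upper capacity `V(A) = inf {E[ξ] : 1_A ≤ ξ, ξ ∈ H}`. -/
noncomputable def cap (S : SubLinearExpSpace Ω) (A : Set Ω) : EReal :=
  sInf {r | ∃ ξ ∈ S.H, (∀ ω, A.indicator (fun _ => (1 : ℝ)) ω ≤ ξ ω) ∧ r = S.E ξ}

/-- Two `n`-dimensional random vectors, possibly on different spaces, are identically distributed:
`E₁[φ(X)] = E₂[φ(Y)]` for all `φ ∈ C_{l,Lip}`, whenever both sub-linear expectations are finite. -/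
def IdentDist (S : SubLinearExpSpace Ω) (S' : SubLinearExpSpace Ω') {n : ℕ}
    (X : Fin n → Ω → ℝ) (Y : Fin n → Ω' → ℝ) : Prop :=
  ∀ φ : (Fin n → ℝ) → ℝ, IsLocLip φ →
    S.E (fun ω => φ (fun i => X i ω)) ≠ ⊤ → S.E (fun ω => φ (fun i => X i ω)) ≠ ⊥ →
    S'.E (fun ω => φ (fun i => Y i ω)) ≠ ⊤ → S'.E (fun ω => φ (fun i => Y i ω)) ≠ ⊥ →
    S.E (fun ω => φ (fun i => X i ω)) = S'.E (fun ω => φ (fun i => Y i ω))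

/-- The random vector `Y` is independent to `X`: `E[φ(X, Y)] = E[E[φ(x, Y)]|_{x = X}]` for every
`φ ∈ C_{l,Lip}` with `φ̄(x) = E|φ(x, Y)| < ∞` for all `x` and `E|φ̄(X)| < ∞`.
Under `E|φ(x, Y)| < ∞` both `E|φ(x, Y)|` and `E[φ(x, Y)]` are finite, so `toReal` loses nothing.
The outer expectations in the definition presuppose that their arguments belong to `H`. -/
def Indep (S : SubLinearExpSpace Ω) {m n : ℕ} (Y : Fin n → Ω → ℝ) (X : Fin m → Ω → ℝ) : Prop :=
  ∀ φ : (Fin m → ℝ) × (Fin n → ℝ) → ℝ, IsLocLip φ →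
    (∀ x, S.E (fun ω => |φ (x, fun j => Y j ω)|) < ⊤) →
    (fun ω => |(S.E (fun ω' => |φ (fun i => X i ω, fun j => Y j ω')|)).toReal|) ∈ S.H →
    S.E (fun ω => |(S.E (fun ω' => |φ (fun i => X i ω, fun j => Y j ω')|)).toReal|) < ⊤ →
    (fun ω => (S.E (fun ω' => φ (fun i => X i ω, fun j => Y j ω'))).toReal) ∈ S.H →
    S.E (fun ω => φ (fun i => X i ω, fun j => Y j ω)) =
      S.E (fun ω => (S.E (fun ω' => φ (fun i => X i ω, fun j => Y j ω'))).toReal)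

/-- `X 0, X 1, …` (standing for `X₁, X₂, …`) is a sequence of independent and identically
distributed random variables: each member is distributed like the first one, and each member
after the first is independent to the vector of all its predecessors. -/
def IsIID (S : SubLinearExpSpace Ω) (X : ℕ → Ω → ℝ) : Prop :=
  (∀ i, X i ∈ S.H) ∧
  (∀ i, S.IdentDist S ![X i] ![X 0]) ∧
  (∀ i, S.Indep ![X (i + 1)] (fun j : Fin (i + 1) => X j))

end SubLinearExpSpace

/-- `s ↦ x₀ + ⋯ + x_{⌊s⌋ - 1} + (s - ⌊s⌋) x_{⌊s⌋}`: the partial sums of `x`, linearly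
interpolated between consecutive integers. -/
noncomputable def interpSum (x : ℕ → ℝ) (s : ℝ) : ℝ :=
  (∑ i ∈ Finset.range ⌊s⌋₊, x i) + (s - ⌊s⌋₊) * x ⌊s⌋₊

theorem interpSum_eq_sum (x : ℕ → ℝ) (n : ℕ) (s : ℝ) (hs : 0 ≤ s) (hn : s ≤ n) :
    interpSum x s = ∑ i ∈ Finset.range (n + 1), max 0 (min 1 (s - i)) * x i := by
  have hk : ⌊s⌋₊ ≤ n := by
    have := Nat.floor_le_floor hn
    simpa using this
  have h1 := Nat.floor_le hs
  have h2 := Nat.lt_floor_add_one s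
  have hsub : Finset.range (⌊s⌋₊ + 1) ⊆ Finset.range (n + 1) :=
    Finset.range_subset_range.2 (by omega)
  rw [← Finset.sum_subset hsub, Finset.sum_range_succ, interpSum]
  · congr 1
    · refine Finset.sum_congr rfl fun i hi => ?_
      have hi' : ((i : ℝ) + 1) ≤ (⌊s⌋₊ : ℝ) := by
        exact_mod_cast Finset.mem_range.1 hi
      rw [min_eq_left (by linarith), max_eq_right zero_le_one, one_mul]
    · rw [min_eq_right (by linarith), max_eq_right (by linarith)]
  · intro i _ hi
    have hi' : ((⌊s⌋₊ : ℝ) + 1) ≤ (i : ℝ) := by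
      have : ⌊s⌋₊ + 1 ≤ i := by simpa using hi
      exact_mod_cast this
    rw [max_eq_left, zero_mul]
    exact (min_le_right _ _).trans (by linarith)

theorem continuous_interpSum (x : ℕ → ℝ) (n : ℕ) :
    Continuous (fun t : unitInterval => interpSum x (n * (t : ℝ)) / Real.sqrt n) := by
  have h : (fun t : unitInterval => interpSum x (n * (t : ℝ)) / Real.sqrt n) =
      fun t : unitInterval => (∑ i ∈ Finset.range (n + 1),
        max 0 (min 1 ((n : ℝ) * (t : ℝ) - i)) * x i) / Real.sqrt n := by
    funext t
    rw [interpSum_eq_sum x n _ (mul_nonneg (Nat.cast_nonneg n) t.2.1)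
      (mul_le_of_le_one_right (Nat.cast_nonneg n) t.2.2)]
  rw [h]
  fun_prop

/-- The normalized polygonal path with
`W_n(t) = (S_{[nt]} + (nt - [nt]) X_{[nt]+1}) / √n`, `0 ≤ t ≤ 1`, as an element of `C[0,1]`,
built from the steps `x 0, x 1, …` (standing for `X₁, X₂, …`). -/
noncomputable def polyPath (x : ℕ → ℝ) (n : ℕ) : C(unitInterval, ℝ) :=
  ⟨fun t => interpSum x (n * (t : ℝ)) / Real.sqrt n, continuous_interpSum x n⟩

/-- The modulus of continuity `ω_δ(f) = sup {|f(t) - f(s)| : |t - s| < δ}`.  The set is bounded,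
and it is nonempty for `δ > 0`. -/
noncomputable def modCont (δ : ℝ) (f : C(unitInterval, ℝ)) : ℝ :=
  sSup {r | ∃ s t : unitInterval, |(t : ℝ) - (s : ℝ)| < δ ∧ r = |f t - f s|}

/-! Tightness in `C[0,1]` comes from a maximal inequality over short blocks. Since capacity is only
finitely subadditive here and independence only runs forward in time, the maximum is reached without
stopping times: for the walk reflected at zero, R ↦ max (R + y) 0, the terminal value dominates
every sum of the last steps of the block. Bounding R for the steps and for their negatives therefore
controls every increment inside the block.

R is bounded through the Lyapunov function (r² + c²)², capped at level B. If the steps are bounded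
by c and have upper mean at most s/(2c) and upper second moment at most s, one step multiplies its
upper expectation by at most 1 + 10 s/c² (`E_quartic_add_le`, iterated through `IsIID.E_step_le`).
Only upper bounds on means are needed, because r ≥ 0 makes the coefficient of the linear term
nonnegative.

Truncate at c = √(δn). Over a block of about δn steps the growth factor stays below exp (20 s), so
with B of order ε√n each block fails with capacity O(δ²/ε⁴). Summing over about 1/δ blocks leaves
O(δ/ε⁴). The truncation error is of order 1/δ times the upper expectation of (X² - c²/4)⁺, which
vanishes as n grows with δ fixed. The finitely many remaining n are handled one at a time.

For the compact set, countably many modulus conditions must hold at once. Off a set of small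
capacity the path for a given n is Lipschitz, so all but finitely many conditions are automatic and
a finite union bound suffices. -/

theorem LipschitzWith.isLocLip {V : Type*} [NormedAddCommGroup V] {K : NNReal} {φ : V → ℝ}
    (h : LipschitzWith K φ) : IsLocLip φ := by
  refine ⟨K + 1, by positivity, 0, fun x y => ?_⟩
  have h1 := h.dist_le_mul x y
  rw [Real.dist_eq, dist_eq_norm] at h1
  have := norm_nonneg (x - y)
  have hK : (0 : ℝ) ≤ K := K.2
  simp only [pow_zero]
  nlinarith [mul_nonneg hK this]

theorem lipschitzWith_abs : LipschitzWith 1 (fun x : ℝ => |x|) :=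
  LipschitzWith.of_dist_le_mul fun x y => by
    simpa [Real.dist_eq] using abs_abs_sub_abs_le x y

/-! ### Basic bounds for the expectation and finite subadditivity of capacity. -/

namespace SubLinearExpSpace

variable {Ω : Type*} (S : SubLinearExpSpace Ω)

theorem const_mem (c : ℝ) : (fun _ : Ω => c) ∈ S.H :=
  S.comp_mem 0 (fun i => i.elim0) (fun i => i.elim0) (fun _ => c)
    (Or.inl ⟨continuous_const, |c|, fun _ => le_rfl⟩)

theorem comp_mem_one {φ : ℝ → ℝ} (hφ : IsLocLip φ) {X : Ω → ℝ} (hX : X ∈ S.H) :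
    (fun ω => φ (X ω)) ∈ S.H := by
  refine S.comp_mem 1 (fun _ => X) (fun _ => hX) (fun x => φ (x 0)) (Or.inr ?_)
  obtain ⟨C, hC, m, h⟩ := hφ
  refine ⟨C, hC, m, fun x y => (h _ _).trans ?_⟩
  have h1 := norm_le_pi_norm x 0
  have h2 := norm_le_pi_norm y 0
  have h3 := norm_le_pi_norm (x - y) 0
  rw [Pi.sub_apply] at h3
  gcongr

variable {S}

theorem E_le_of_le {X : Ω → ℝ} (hX : X ∈ S.H) {c : ℝ} (h : ∀ ω, X ω ≤ c) : S.E X ≤ (c : EReal) :=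
  (S.mono _ (S.const_mem c) _ hX h).trans_eq (S.const c)

theorem le_E_of_le {X : Ω → ℝ} (hX : X ∈ S.H) {c : ℝ} (h : ∀ ω, c ≤ X ω) : (c : EReal) ≤ S.E X :=
  (S.const c).symm.trans_le (S.mono _ hX _ (S.const_mem c) h)

theorem E_add_le {X Y : Ω → ℝ} (hX : X ∈ S.H) (hY : Y ∈ S.H) {a b : ℝ}
    (ha : S.E X ≤ (a : EReal)) (hb : S.E Y ≤ (b : EReal)) :
    S.E (X + Y) ≤ ((a + b : ℝ) : EReal) := by
  have h1 : S.E X ≠ ⊤ := (ha.trans_lt (EReal.coe_lt_top a)).ne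
  have h2 : S.E Y ≠ ⊤ := (hb.trans_lt (EReal.coe_lt_top b)).ne
  refine (S.subadd X hX Y hY (fun h => h1 h.1) (fun h => h2 h.2)).trans ?_
  rw [EReal.coe_add]
  exact add_le_add ha hb

theorem E_smul_le {X : Ω → ℝ} (hX : X ∈ S.H) {a c : ℝ} (hc : 0 ≤ c)
    (ha : S.E X ≤ (a : EReal)) : S.E (c • X) ≤ ((c * a : ℝ) : EReal) := by
  rw [S.pos_homog X hX c hc, EReal.coe_mul]
  exact mul_le_mul_of_nonneg_left ha (EReal.coe_nonneg.2 hc)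

theorem coe_toReal_E {X : Ω → ℝ} (hX : X ∈ S.H) {M : ℝ} (h : ∀ ω, |X ω| ≤ M) :
    (((S.E X).toReal : ℝ) : EReal) = S.E X := by
  refine EReal.coe_toReal ?_ ?_
  · exact ((E_le_of_le hX fun ω => (abs_le.1 (h ω)).2).trans_lt (EReal.coe_lt_top M)).ne
  · exact ((EReal.bot_lt_coe (-M)).trans_le (le_E_of_le hX fun ω => (abs_le.1 (h ω)).1)).ne'

/-- Some member of `H` dominates the indicator of `A` and has expectation at most `a`. -/
def CapLE (S : SubLinearExpSpace Ω) (A : Set Ω) (a : ℝ) : Prop :=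
  ∃ ξ ∈ S.H, (∀ ω, A.indicator (fun _ => (1 : ℝ)) ω ≤ ξ ω) ∧ S.E ξ ≤ (a : EReal)

theorem CapLE.cap_le {A : Set Ω} {a : ℝ} (h : S.CapLE A a) : S.cap A ≤ (a : EReal) := by
  obtain ⟨ξ, h1, h2, h3⟩ := h
  refine le_trans ?_ h3
  rw [cap]
  exact sInf_le ⟨ξ, h1, h2, rfl⟩

theorem cap_nonneg (A : Set Ω) : 0 ≤ S.cap A := by
  refine le_sInf ?_
  rintro r ⟨ξ, h1, h2, rfl⟩
  exact le_E_of_le (c := 0) h1 fun ω =>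
    (Set.indicator_nonneg (fun _ _ => zero_le_one) ω).trans (h2 ω)

theorem CapLE.mono {A B : Set Ω} {a b : ℝ} (h : S.CapLE B b) (hAB : A ⊆ B) (hab : b ≤ a) :
    S.CapLE A a := by
  obtain ⟨ξ, h1, h2, h3⟩ := h
  refine ⟨ξ, h1, fun ω => le_trans ?_ (h2 ω), h3.trans (EReal.coe_le_coe_iff.2 hab)⟩
  exact Set.indicator_le_indicator_of_subset hAB (fun _ => zero_le_one) ω

theorem CapLE.union {A B : Set Ω} {a b : ℝ} (hA : S.CapLE A a) (hB : S.CapLE B b) :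
    S.CapLE (A ∪ B) (a + b) := by
  obtain ⟨ξ, h1, h2, h3⟩ := hA
  obtain ⟨ζ, k1, k2, k3⟩ := hB
  refine ⟨ξ + ζ, S.H.add_mem h1 k1, fun ω => ?_, E_add_le h1 k1 h3 k3⟩
  have h4 := h2 ω
  have k4 := k2 ω
  by_cases hA : ω ∈ A <;> by_cases hB : ω ∈ B <;>
    simp [hA, hB] at h4 k4 ⊢ <;> linarith

theorem CapLE.empty : S.CapLE ∅ 0 :=
  ⟨fun _ => 0, S.const_mem 0, fun ω => by simp, (S.const 0).le⟩

theorem CapLE.biUnion {ι : Type*} (s : Finset ι) {A : ι → Set Ω} {a : ι → ℝ}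
    (h : ∀ i ∈ s, S.CapLE (A i) (a i)) : S.CapLE (⋃ i ∈ s, A i) (∑ i ∈ s, a i) := by
  classical
  induction s using Finset.induction_on with
  | empty => simpa using CapLE.empty
  | insert i s hi ih =>
    rw [Finset.sum_insert hi, Finset.set_biUnion_insert]
    exact (h i (by simp)).union (ih fun j hj => h j (by simp [hj]))

/-! ### Conditioning one step on the past. -/

/-- The random variable `Z` is a Lipschitz function of `X 0, …, X (i - 1)`. -/
def LipAdapted (X : ℕ → Ω → ℝ) (i : ℕ) (Z : Ω → ℝ) : Prop :=
  ∃ (K : NNReal) (ρ : (Fin i → ℝ) → ℝ), LipschitzWith K ρ ∧ ∀ ω, Z ω = ρ (fun j => X j ω)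

theorem LipAdapted.zero (X : ℕ → Ω → ℝ) (i : ℕ) : LipAdapted X i (fun _ => 0) :=
  ⟨0, fun _ => 0, LipschitzWith.const 0, fun _ => rfl⟩

theorem LipAdapted.step {X : ℕ → Ω → ℝ} {i : ℕ} {Z : Ω → ℝ} (hZ : LipAdapted X i Z)
    {g : ℝ → ℝ} {L : NNReal} (hg : LipschitzWith L g) :
    LipAdapted X (i + 1) (fun ω => max (Z ω + g (X i ω)) 0) := by
  obtain ⟨K, ρ, hρ, h⟩ := hZ
  have h1 : LipschitzWith 1 (fun x : Fin (i + 1) → ℝ => fun j : Fin i => x j.castSucc) :=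
    LipschitzWith.of_dist_le_mul fun x y => by
      rw [NNReal.coe_one, one_mul, dist_pi_le_iff dist_nonneg]
      exact fun j => dist_le_pi_dist x y j.castSucc
  have h2 : LipschitzWith 1 (fun x : Fin (i + 1) → ℝ => x (Fin.last i)) :=
    LipschitzWith.eval (Fin.last i)
  refine ⟨_, _, ((hρ.comp h1).add (hg.comp h2)).max_const 0, fun ω => ?_⟩
  simp [h]

/-- One-step estimate: a bound for `E[F(z, X i)]` at all fixed `z` bounds `E[F(Z, X i)]` for `Z`
depending on the past of the sequence. -/
theorem IsIID.E_step_le {X : ℕ → Ω → ℝ} (hX : S.IsIID X) {i : ℕ} {Z : Ω → ℝ}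
    (hZ : LipAdapted X i Z) {F : ℝ × ℝ → ℝ} {L : NNReal} (hF : LipschitzWith L F) {M : ℝ}
    (hM : ∀ p, |F p| ≤ M) {ψ : ℝ → ℝ} {L' : NNReal} (hψ : LipschitzWith L' ψ)
    (h : ∀ z, S.E (fun ω => F (z, X i ω)) ≤ (ψ z : EReal)) :
    S.E (fun ω => F (Z ω, X i ω)) ≤ S.E (fun ω => ψ (Z ω)) := by
  obtain ⟨K, ρ, hρ, hZρ⟩ := hZ
  obtain ⟨hmem, -, hind⟩ := hX
  simp only [hZρ]
  have hprefix : ∀ (f : (Fin i → ℝ) → ℝ) (K : NNReal), LipschitzWith K f →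
      (fun ω => f (fun j => X j ω)) ∈ S.H := fun f K hf =>
    S.comp_mem i (fun j => X j) (fun j => hmem j) f (Or.inr hf.isLocLip)
  have hsec : ∀ (G : ℝ × ℝ → ℝ), LipschitzWith L G → ∀ z, (fun ω => G (z, X i ω)) ∈ S.H := by
    intro G hG z
    refine S.comp_mem_one (φ := fun y => G (z, y)) ?_ (hmem i)
    exact (hG.comp (LipschitzWith.prodMk_left z)).isLocLip
  -- Integrating out the last variable preserves the Lipschitz constant; this puts the inner
  -- expectations required by `Indep` into `H`.
  have hlip : ∀ G : ℝ × ℝ → ℝ, LipschitzWith L G → (∀ p, |G p| ≤ M) →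
      LipschitzWith L (fun z => (S.E (fun ω => G (z, X i ω))).toReal) := by
    intro G hG hGM
    refine LipschitzWith.of_le_add_mul _ fun z w => ?_
    have hc := coe_toReal_E (hsec G hG z) fun ω => hGM _
    have hd := coe_toReal_E (hsec G hG w) fun ω => hGM _
    rw [← EReal.coe_le_coe_iff, hc]
    refine (S.mono _ (S.H.add_mem (hsec G hG w) (S.const_mem (L * dist z w))) _
      (hsec G hG z) fun ω => ?_).trans
      (E_add_le (hsec G hG w) (S.const_mem _) hd.ge (S.const _).le)
    have := hG.dist_le_mul (z, X i ω) (w, X i ω)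
    rw [Real.dist_eq, Prod.dist_eq, dist_self, max_eq_left dist_nonneg] at this
    have h2 := le_abs_self (G (z, X i ω) - G (w, X i ω))
    simp only [Pi.add_apply]
    linarith
  have habs : LipschitzWith L (fun p => |F p|) := by
    have := lipschitzWith_abs.comp hF
    rwa [one_mul] at this
  have hM' : ∀ p, |(|F p|)| ≤ M := fun p => by rw [abs_abs]; exact hM p
  have hreal : ∀ z, (S.E (fun ω => F (z, X i ω))).toReal ≤ ψ z := fun z => by
    rw [← EReal.coe_le_coe_iff, coe_toReal_E (hsec F hF z) fun ω => hM _]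
    exact h z
  -- With no past, `Z` is constant and no independence is needed; `Indep` only speaks of the later
  -- variables.
  cases i with
  | zero =>
    have h0 : ∀ ω, (fun j : Fin 0 => X j ω) = Fin.elim0 := fun ω => Subsingleton.elim _ _
    simp only [h0, S.const]
    exact h _
  | succ k =>
    have hφ : ∀ G : ℝ × ℝ → ℝ, LipschitzWith L G →
        IsLocLip (fun p : (Fin (k + 1) → ℝ) × (Fin 1 → ℝ) => G (ρ p.1, p.2 0)) := by
      intro G hG
      exact (hG.comp ((hρ.comp LipschitzWith.prod_fst).prodMk
        ((LipschitzWith.eval (0 : Fin 1)).comp LipschitzWith.prod_snd))).isLocLip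
    have key := hind k (fun p => F (ρ p.1, p.2 0)) (hφ F hF)
    simp only [Matrix.cons_val_zero] at key
    have hH1 := hprefix _ _ ((hlip _ habs hM').comp hρ)
    have hH2 := hprefix _ _ ((hlip F hF hM).comp hρ)
    have hbd : ∀ z, |(S.E (fun ω => |F (z, X (k + 1) ω)|)).toReal| ≤ M := by
      intro z
      have h1 : (0 : EReal) ≤ S.E (fun ω => |F (z, X (k + 1) ω)|) :=
        le_E_of_le (c := 0) (hsec _ habs z) fun ω => abs_nonneg _
      rw [abs_of_nonneg (EReal.toReal_nonneg h1), ← EReal.coe_le_coe_iff,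
        coe_toReal_E (hsec _ habs z) fun ω => hM' _]
      exact E_le_of_le (hsec _ habs z) fun ω => hM _
    have hH3 : (fun ω => |(S.E (fun ω' => |F (ρ (fun j : Fin (k + 1) => X j ω),
        X (k + 1) ω')|)).toReal|) ∈ S.H := by
      convert hH1 using 2 with ω
      exact abs_of_nonneg (EReal.toReal_nonneg
        (le_E_of_le (c := 0) (hsec _ habs _) fun ω => abs_nonneg _))
    rw [key _ hH3 _ hH2]
    · exact S.mono _ (hprefix _ _ (hψ.comp hρ)) _ hH2 fun ω => hreal _
    · exact fun x => (E_le_of_le (hsec _ habs _) fun ω => hM _).trans_lt (EReal.coe_lt_top M)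
    · exact (E_le_of_le hH3 fun ω => hbd _).trans_lt (EReal.coe_lt_top M)

/-- Boundedness of `φ` supplies the finiteness that `IdentDist` asks for. -/
theorem IsIID.E_comp_eq {X : ℕ → Ω → ℝ} (hX : S.IsIID X) (i : ℕ) {φ : ℝ → ℝ} {L : NNReal}
    (hφ : LipschitzWith L φ) {M : ℝ} (hM : ∀ x, |φ x| ≤ M) :
    S.E (fun ω => φ (X i ω)) = S.E (fun ω => φ (X 0 ω)) := by
  have hmem : ∀ j, (fun ω => φ (X j ω)) ∈ S.H := fun j => S.comp_mem_one hφ.isLocLip (hX.1 j)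
  have hne : ∀ j, S.E (fun ω => φ (X j ω)) ≠ ⊤ ∧ S.E (fun ω => φ (X j ω)) ≠ ⊥ := fun j => by
    rw [← coe_toReal_E (hmem j) fun ω => hM _]
    exact ⟨EReal.coe_ne_top _, EReal.coe_ne_bot _⟩
  have := hX.2.1 i (fun x => φ (x 0)) (hφ.comp (LipschitzWith.eval (0 : Fin 1))).isLocLip
  simp only [Matrix.cons_val_zero] at this
  exact this (hne i).1 (hne i).2 (hne 0).1 (hne 0).2

end SubLinearExpSpace

/-! ### Truncation. -/

/-- Truncation of a real number at the levels `±c`. -/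
noncomputable def truncAt (c x : ℝ) : ℝ := max (-c) (min x c)

theorem lipschitzWith_truncAt (c : ℝ) : LipschitzWith 1 (truncAt c) :=
  (LipschitzWith.id.min_const c).const_max (-c)

theorem abs_truncAt_le {c : ℝ} (hc : 0 ≤ c) (x : ℝ) : |truncAt c x| ≤ c :=
  abs_le.2 ⟨le_max_left _ _, max_le (by linarith) (min_le_right _ _)⟩

theorem truncAt_eq_self {c x : ℝ} (h : |x| ≤ c) : truncAt c x = x := by
  rw [abs_le] at h
  rw [truncAt, min_eq_left h.2, max_eq_right h.1]

theorem truncAt_sq_le {c : ℝ} (hc : 0 ≤ c) (x : ℝ) : truncAt c x ^ 2 ≤ x ^ 2 := by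
  unfold truncAt
  rcases le_total x c with h | h
  · rw [min_eq_left h]
    rcases le_total (-c) x with h' | h'
    · rw [max_eq_right h']
    · rw [max_eq_left h']; nlinarith
  · rw [min_eq_right h, max_eq_right (by linarith)]; nlinarith

/-- The excess |x| - c is at most x²/(2c), by expanding (|x| - c)² ≥ 0 and more. This turns mean
zero into a drift of at most s/(2c) after truncation. -/
theorem abs_truncAt_sub_le {c : ℝ} (hc : 0 < c) (x : ℝ) :
    |truncAt c x - x| ≤ (2 * c)⁻¹ * x ^ 2 := by
  have key : ∀ y : ℝ, y - c ≤ (2 * c)⁻¹ * y ^ 2 := fun y => by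
    rw [inv_mul_eq_div, le_div_iff₀ (by positivity)]
    nlinarith [sq_nonneg (y - c)]
  have h0 : 0 ≤ (2 * c)⁻¹ * x ^ 2 := by positivity
  have h1 := key x
  have h2 := key (-x)
  rw [neg_sq] at h2
  unfold truncAt
  rw [abs_le]
  rcases le_total x c with h | h
  · rw [min_eq_left h]
    rcases le_total (-c) x with h' | h'
    · rw [max_eq_right h']; constructor <;> linarith
    · rw [max_eq_left h']; constructor <;> linarith
  · rw [min_eq_right h, max_eq_right (by linarith)]; constructor <;> linarith

theorem LipschitzWith.sq_of_abs_le {g : ℝ → ℝ} {L : NNReal} (hg : LipschitzWith L g) {c : ℝ}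
    (hc : 0 ≤ c) (hgc : ∀ x, |g x| ≤ c) :
    LipschitzWith (Real.toNNReal (2 * c) * L) (fun x => g x ^ 2) := by
  refine LipschitzWith.of_dist_le_mul fun x y => ?_
  have h := hg.dist_le_mul x y
  rw [NNReal.coe_mul, Real.coe_toNNReal _ (by positivity), mul_assoc, Real.dist_eq,
    sq_sub_sq, abs_mul]
  have h1 : |g x + g y| ≤ 2 * c := (abs_add_le _ _).trans (by linarith [hgc x, hgc y])
  rw [Real.dist_eq] at h
  gcongr

/-! ### The quartic Lyapunov function. -/

/-- A bounded Lipschitz version of `r ↦ (r² + c²)²` on `[0, B]`, normalized to be `1` at `B`. -/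
noncomputable def quartic (c B r : ℝ) : ℝ :=
  ((max 0 (min r B)) ^ 2 + c ^ 2) ^ 2 / (B ^ 2 + c ^ 2) ^ 2

section quartic

variable {c B : ℝ}

theorem quartic_nonneg (c B r : ℝ) : 0 ≤ quartic c B r := by unfold quartic; positivity

theorem quartic_mono (c B : ℝ) : Monotone (quartic c B) := by
  intro r s h
  unfold quartic
  gcongr

theorem quartic_max_zero (hB : 0 ≤ B) (r : ℝ) : quartic c B (max r 0) = quartic c B r := by
  unfold quartic
  congr 4
  rcases le_total r 0 with h | h
  · rw [max_eq_right h, min_eq_left hB, max_self, min_eq_left (h.trans hB), max_eq_left h]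
  · rw [max_eq_left h]

theorem quartic_eq_one (hB : 0 < B) {r : ℝ} (h : B ≤ r) : quartic c B r = 1 := by
  unfold quartic
  rw [min_eq_right h, max_eq_right hB.le]
  exact div_self (by positivity)

theorem quartic_le_one (hB : 0 < B) (r : ℝ) : quartic c B r ≤ 1 :=
  (quartic_mono c B (le_max_left r B)).trans_eq (quartic_eq_one hB (le_max_right r B))

theorem abs_quartic_le (hB : 0 < B) (r : ℝ) : |quartic c B r| ≤ 1 := by
  rw [abs_of_nonneg (quartic_nonneg c B r)]
  exact quartic_le_one hB r

theorem quartic_zero (hB : 0 ≤ B) : quartic c B 0 = c ^ 4 / (B ^ 2 + c ^ 2) ^ 2 := by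
  unfold quartic
  rw [min_eq_left hB, max_self]
  ring

theorem exists_lipschitzWith_quartic (c : ℝ) (hB : 0 < B) :
    ∃ L, LipschitzWith L (quartic c B) := by
  have hw : LipschitzWith 1 (fun r : ℝ => max 0 (min r B)) := by
    simpa using (LipschitzWith.id.min_const B).const_max 0
  refine ⟨Real.toNNReal (2 * B * (2 * B ^ 2 + 2 * c ^ 2) / (B ^ 2 + c ^ 2) ^ 2),
    LipschitzWith.of_dist_le_mul fun x y => ?_⟩
  rw [Real.coe_toNNReal _ (by positivity), Real.dist_eq]
  have h := hw.dist_le_mul x y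
  rw [NNReal.coe_one, one_mul, Real.dist_eq] at h
  unfold quartic
  have ha : 0 ≤ max 0 (min x B) := le_max_left _ _
  have hb : 0 ≤ max 0 (min y B) := le_max_left _ _
  have ha' : max 0 (min x B) ≤ B := max_le hB.le (min_le_right _ _)
  have hb' : max 0 (min y B) ≤ B := max_le hB.le (min_le_right _ _)
  generalize max 0 (min x B) = a at *
  generalize max 0 (min y B) = b at *
  rw [← sub_div, abs_div, abs_of_pos (by positivity : 0 < (B ^ 2 + c ^ 2) ^ 2), div_mul_eq_mul_div]
  gcongr
  rw [show (a ^ 2 + c ^ 2) ^ 2 - (b ^ 2 + c ^ 2) ^ 2 =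
    (a + b) * (a ^ 2 + b ^ 2 + 2 * c ^ 2) * (a - b) by ring, abs_mul,
    abs_of_nonneg (by positivity)]
  have h1 : a + b ≤ 2 * B := by linarith
  have h2 : a ^ 2 + b ^ 2 + 2 * c ^ 2 ≤ 2 * B ^ 2 + 2 * c ^ 2 := by nlinarith
  have h3 : |a - b| ≤ dist x y := h
  gcongr

/-- Expanding the fourth power, the cubic term is absorbed by 2rx ≤ r² + x² and the remaining x⁴ by
x² ≤ c². This leaves (8r² + 5c²)x², rounded up to 9(r² + c²)x². -/
theorem sq_add_sq_sq_le {r x w : ℝ} (hx : |x| ≤ c) (hw : w ^ 2 ≤ (r + x) ^ 2) :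
    (w ^ 2 + c ^ 2) ^ 2 ≤
      (r ^ 2 + c ^ 2) ^ 2 + 4 * (r ^ 2 + c ^ 2) * r * x + 9 * (r ^ 2 + c ^ 2) * x ^ 2 := by
  have hx2 : x ^ 2 ≤ c ^ 2 := sq_le_sq' (abs_le.1 hx).1 (abs_le.1 hx).2
  have h1 : (w ^ 2 + c ^ 2) ^ 2 ≤ ((r + x) ^ 2 + c ^ 2) ^ 2 := by gcongr
  have h2 : 4 * r * x * x ^ 2 ≤ 2 * (r ^ 2 + x ^ 2) * x ^ 2 := by
    have : 4 * r * x ≤ 2 * (r ^ 2 + x ^ 2) := by nlinarith [sq_nonneg (r - x)]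
    exact mul_le_mul_of_nonneg_right this (sq_nonneg x)
  have h3 : 0 ≤ (c ^ 2 - x ^ 2) * x ^ 2 := mul_nonneg (by linarith) (sq_nonneg x)
  have h4 : 0 ≤ r ^ 2 * x ^ 2 := by positivity
  have h5 : 0 ≤ c ^ 2 * x ^ 2 := by positivity
  nlinarith

/-- Capping and reflecting only lower the new value, so the polynomial estimate survives with r =
max z 0, and both coefficients are nonnegative (for the use of positive homogeneity). -/
theorem quartic_add_le {z x : ℝ} (hB : 0 < B) (hz : z ≤ B) (hx : |x| ≤ c) :
    quartic c B (z + x) ≤ quartic c B z +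
      (4 * ((max z 0) ^ 2 + c ^ 2) * max z 0 / (B ^ 2 + c ^ 2) ^ 2 * x +
      9 * ((max z 0) ^ 2 + c ^ 2) / (B ^ 2 + c ^ 2) ^ 2 * x ^ 2) := by
  have hw : (max 0 (min (z + x) B)) ^ 2 ≤ (max z 0 + x) ^ 2 := by
    rw [sq_le_sq, abs_of_nonneg (le_max_left _ _)]
    refine max_le (abs_nonneg _) ((min_le_left _ _).trans (le_trans ?_ (le_abs_self _)))
    linarith [le_max_left z 0]
  have h := sq_add_sq_sq_le hx hw
  unfold quartic
  rw [min_eq_left hz, max_comm 0 z, div_mul_eq_mul_div, div_mul_eq_mul_div, ← add_div, ← add_div]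
  gcongr
  linarith

end quartic

/-! ### Moment growth of the reflected walk and tails of single variables. -/

/-- The walk with steps `y` reflected at `0`: the maximal sum of the last steps. -/
noncomputable def reflWalk (y : ℕ → ℝ) : ℕ → ℝ
  | 0 => 0
  | k + 1 => max (reflWalk y k + y k) 0

namespace SubLinearExpSpace

variable {Ω : Type*} {S : SubLinearExpSpace Ω} {X : ℕ → Ω → ℝ}

theorem LipAdapted.reflWalk (X : ℕ → Ω → ℝ) {g : ℝ → ℝ} {L : NNReal} (hg : LipschitzWith L g)
    (a k : ℕ) : LipAdapted X (a + k) (fun ω => reflWalk (fun i => g (X (a + i) ω)) k) := by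
  induction k with
  | zero => exact LipAdapted.zero X _
  | succ k ih => exact ih.step hg

/-- The first- and second-order terms are each a multiple of (r² + c²)²: use 2rc ≤ r² + c² for the
drift and c² ≤ r² + c² for the variance. Above the cap the function is already at its maximum 1. -/
theorem E_quartic_add_le {Y : Ω → ℝ} {c B μ s : ℝ} (hc : 0 < c) (hB : 0 < B) (hμ : 0 ≤ μ)
    (hs : 0 ≤ s) (hY : Y ∈ S.H) (hY2 : (fun ω => Y ω ^ 2) ∈ S.H) (hYc : ∀ ω, |Y ω| ≤ c)
    (h1 : S.E Y ≤ (μ : EReal)) (h2 : S.E (fun ω => Y ω ^ 2) ≤ (s : EReal)) (z : ℝ) :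
    S.E (fun ω => quartic c B (z + Y ω)) ≤
      (((1 + (2 * μ / c + 9 * s / c ^ 2)) * quartic c B z : ℝ) : EReal) := by
  obtain ⟨L, hL⟩ := exists_lipschitzWith_quartic c hB
  have hmem : (fun ω => quartic c B (z + Y ω)) ∈ S.H :=
    S.comp_mem_one (φ := fun y => quartic c B (z + y))
      ((hL.comp ((LipschitzWith.const z).add LipschitzWith.id)).isLocLip) hY
  have hκ : 0 ≤ 2 * μ / c + 9 * s / c ^ 2 := by positivity
  have hq := quartic_nonneg c B z
  rcases le_total z B with hz | hz
  · set r := max z 0 with hr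
    have hr0 : 0 ≤ r := le_max_right _ _
    set D := (B ^ 2 + c ^ 2) ^ 2 with hD
    have hD0 : 0 < D := by positivity
    set α := 4 * (r ^ 2 + c ^ 2) * r / D with hα
    set β := 9 * (r ^ 2 + c ^ 2) / D with hβ
    have hα0 : 0 ≤ α := by positivity
    have hβ0 : 0 ≤ β := by positivity
    have hm1 := S.H.smul_mem α hY
    have hm2 := S.H.smul_mem β hY2
    refine (S.mono _ (S.H.add_mem (S.const_mem (quartic c B z)) (S.H.add_mem hm1 hm2)) _ hmem
      fun ω => ?_).trans ((E_add_le (S.const_mem _) (S.H.add_mem hm1 hm2) (S.const _).le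
        (E_add_le hm1 hm2 (E_smul_le hY hα0 h1) (E_smul_le hY2 hβ0 h2))).trans ?_)
    · exact quartic_add_le hB hz (hYc ω)
    · rw [EReal.coe_le_coe_iff]
      have hqz : quartic c B z = (r ^ 2 + c ^ 2) ^ 2 / D := by
        rw [quartic, min_eq_left hz, max_comm, hr, hD]
      have e1 : α * μ ≤ 2 * μ / c * quartic c B z := by
        rw [hqz, hα, div_mul_div_comm, div_mul_eq_mul_div, div_le_div_iff₀ hD0 (by positivity)]
        have : 0 ≤ (r - c) ^ 2 * ((r ^ 2 + c ^ 2) * μ * D) := by positivity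
        nlinarith
      have e2 : β * s ≤ 9 * s / c ^ 2 * quartic c B z := by
        rw [hqz, hβ, div_mul_div_comm, div_mul_eq_mul_div, div_le_div_iff₀ hD0 (by positivity)]
        have : 0 ≤ r ^ 2 * ((r ^ 2 + c ^ 2) * s * D) := by positivity
        nlinarith
      linarith
  · refine (E_le_of_le hmem fun ω => quartic_le_one hB _).trans ?_
    rw [EReal.coe_le_coe_iff, quartic_eq_one hB hz]
    linarith

theorem IsIID.E_quartic_reflWalk_le (hX : S.IsIID X) {g : ℝ → ℝ} {L : NNReal}
    (hg : LipschitzWith L g) {c B μ s : ℝ} (hc : 0 < c) (hB : 0 < B) (hμ : 0 ≤ μ)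
    (hs : 0 ≤ s) (hgc : ∀ x, |g x| ≤ c)
    (h1 : S.E (fun ω => g (X 0 ω)) ≤ (μ : EReal))
    (h2 : S.E (fun ω => g (X 0 ω) ^ 2) ≤ (s : EReal)) (a k : ℕ) :
    S.E (fun ω => quartic c B (reflWalk (fun i => g (X (a + i) ω)) k)) ≤
      (((1 + (2 * μ / c + 9 * s / c ^ 2)) ^ k * quartic c B 0 : ℝ) : EReal) := by
  have hL' := hg.sq_of_abs_le hc.le hgc
  obtain ⟨K, hK⟩ := exists_lipschitzWith_quartic c hB
  have hκ : 0 ≤ 1 + (2 * μ / c + 9 * s / c ^ 2) := by positivity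
  induction k with
  | zero => simpa [reflWalk] using (S.const _).le
  | succ k ih =>
    have had := LipAdapted.reflWalk X hg a k
    have hmem : (fun ω => quartic c B (reflWalk (fun i => g (X (a + i) ω)) k)) ∈ S.H := by
      obtain ⟨K', ρ, hρ, h⟩ := had
      simp only [h]
      exact S.comp_mem _ (fun j => X j) (fun j => hX.1 j) (fun x => quartic c B (ρ x))
        (Or.inr (hK.comp hρ).isLocLip)
    have hF : LipschitzWith _ (fun p : ℝ × ℝ => quartic c B (p.1 + g p.2)) :=
      hK.comp (LipschitzWith.prod_fst.add (hg.comp LipschitzWith.prod_snd))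
    have hstep := hX.E_step_le had hF (fun p => abs_quartic_le hB _)
      (ψ := fun z => (1 + (2 * μ / c + 9 * s / c ^ 2)) • quartic c B z)
      ((lipschitzWith_smul _).comp hK) (fun z => by
        refine E_quartic_add_le hc hB hμ hs (S.comp_mem_one hg.isLocLip (hX.1 _))
          (S.comp_mem_one hL'.isLocLip (hX.1 _)) (fun ω => hgc _) ?_ ?_ z
        · rwa [hX.E_comp_eq _ hg hgc]
        · rwa [hX.E_comp_eq _ hL' (M := c ^ 2) fun x => by
            rw [abs_of_nonneg (sq_nonneg _), ← sq_abs (g x)]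
            exact pow_le_pow_left₀ (abs_nonneg _) (hgc x) 2])
    -- The quartic does not see negative values, so the reflection in the last step can be dropped.
    simp only [reflWalk, quartic_max_zero hB.le]
    refine hstep.trans ((E_smul_le hmem hκ ih).trans_eq ?_)
    rw [pow_succ']
    ring_nf

/-- A Lipschitz ramp from c/2 to c dominates the indicator, and with t = 2|x|/c ≥ 1 it is at most t
- 1 ≤ t² - 1 = (4/c²)(x² - c²/4). The level c²/4 rather than c² makes room for the ramp. -/
theorem IsIID.capLE_abs_gt (hX : S.IsIID X) {c θ : ℝ} (hc : 0 < c)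
    (hθ : S.E (fun ω => max (X 0 ω ^ 2 - c ^ 2 / 4) 0) ≤ (θ : EReal))
    (hmem : (fun ω => max (X 0 ω ^ 2 - c ^ 2 / 4) 0) ∈ S.H) (i : ℕ) :
    S.CapLE {ω | c < |X i ω|} (4 / c ^ 2 * θ) := by
  set h : ℝ → ℝ := fun x => max 0 (min (2 / c * |x| - 1) 1) with hh
  have hL := (((((lipschitzWith_smul (2 / c)).comp lipschitzWith_abs).sub
    (LipschitzWith.const (1 : ℝ))).min_const 1).const_max 0)
  have hL' : LipschitzWith _ h := hL
  have hbd : ∀ x, |h x| ≤ 1 := fun x => abs_le.2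
    ⟨by linarith [le_max_left 0 (min (2 / c * |x| - 1) 1)], max_le zero_le_one (min_le_right _ _)⟩
  refine ⟨fun ω => h (X i ω), S.comp_mem_one hL'.isLocLip (hX.1 i), fun ω => ?_, ?_⟩
  · by_cases hω : c < |X i ω|
    · rw [Set.indicator_of_mem (by exact hω)]
      refine le_max_of_le_right (le_min ?_ le_rfl)
      have : 2 ≤ 2 / c * |X i ω| := by
        rw [div_mul_eq_mul_div, le_div_iff₀ hc]; linarith
      linarith
    · rw [Set.indicator_of_notMem (by exact hω)]
      exact le_max_left _ _
  · rw [hX.E_comp_eq i hL' hbd]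
    refine (S.mono _ (S.H.smul_mem (4 / c ^ 2) hmem) _ (S.comp_mem_one hL'.isLocLip (hX.1 0))
      fun ω => ?_).trans (E_smul_le hmem (by positivity) hθ)
    simp only [Pi.smul_apply, smul_eq_mul]
    set x := X 0 ω
    refine max_le (by positivity) ((min_le_left _ _).trans ?_)
    set t := 2 / c * |x| with ht
    have ht0 : 0 ≤ t := by positivity
    have h4 : 4 / c ^ 2 * (x ^ 2 - c ^ 2 / 4) = t ^ 2 - 1 := by
      rw [ht, mul_pow, sq_abs]; field_simp
      ring
    have h5 : (0 : ℝ) ≤ 4 / c ^ 2 := by positivity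
    rcases le_total t 1 with h1 | h1
    · exact le_trans (by linarith) (mul_nonneg h5 (le_max_right _ _))
    · refine le_trans ?_ (mul_le_mul_of_nonneg_left (le_max_left _ _) h5)
      rw [h4]; nlinarith

end SubLinearExpSpace

/-! ### Deterministic estimates for walks, polygonal paths and moduli. -/

theorem reflWalk_nonneg (y : ℕ → ℝ) (k : ℕ) : 0 ≤ reflWalk y k := by
  cases k with
  | zero => exact le_rfl
  | succ k => exact le_max_right _ _

theorem sum_sub_sum_le_reflWalk (y : ℕ → ℝ) {j k : ℕ} (hjk : j ≤ k) :
    ∑ i ∈ Finset.range k, y i - ∑ i ∈ Finset.range j, y i ≤ reflWalk y k := by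
  induction k, hjk using Nat.le_induction with
  | base => simpa using reflWalk_nonneg y j
  | succ k _ ih =>
    rw [Finset.sum_range_succ]
    exact le_trans (by linarith) (le_max_left (reflWalk y k + y k) 0)

/-- If the reflected walks of `x` and `-x` over a block are below `B`, the partial sums of `x`
oscillate by at most `2 B` over the block. -/
theorem abs_sum_sub_sum_le_of_reflWalk {x : ℕ → ℝ} {a m : ℕ} {B : ℝ}
    (h1 : reflWalk (fun i => x (a + i)) m ≤ B) (h2 : reflWalk (fun i => -x (a + i)) m ≤ B)
    {i k : ℕ} (hai : a ≤ i) (him : i ≤ a + m) (hak : a ≤ k) (hkm : k ≤ a + m) :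
    |∑ l ∈ Finset.range k, x l - ∑ l ∈ Finset.range i, x l| ≤ 2 * B := by
  have key : ∀ j, a ≤ j → j ≤ a + m →
      |∑ l ∈ Finset.range (a + m), x l - ∑ l ∈ Finset.range j, x l| ≤ B := by
    intro j hj hjm
    obtain ⟨d, rfl⟩ := Nat.exists_eq_add_of_le hj
    have e1 := (sum_sub_sum_le_reflWalk (fun i => x (a + i)) (show d ≤ m by omega)).trans h1
    have e2 := (sum_sub_sum_le_reflWalk (fun i => -x (a + i)) (show d ≤ m by omega)).trans h2
    simp only [Finset.sum_neg_distrib] at e2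
    rw [Finset.sum_range_add, Finset.sum_range_add, abs_le]
    constructor <;> linarith
  have e1 := abs_le.1 (key i hai him)
  have e2 := abs_le.1 (key k hak hkm)
  rw [abs_le]
  constructor <;> linarith [e1.1, e1.2, e2.1, e2.2]

/-- A window of at most `m` steps meets at most two adjacent blocks, each contributing at most 2B.
-/
theorem abs_sum_sub_sum_le_of_blocks {x : ℕ → ℝ} {m J : ℕ} (hm : 0 < m) {B : ℝ} (hB : 0 ≤ B)
    (h1 : ∀ j < J, reflWalk (fun i => x (j * m + i)) m ≤ B)
    (h2 : ∀ j < J, reflWalk (fun i => -x (j * m + i)) m ≤ B)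
    {i k : ℕ} (hik : i ≤ k) (hkm : k ≤ i + m) (hkJ : k ≤ J * m) :
    |∑ l ∈ Finset.range k, x l - ∑ l ∈ Finset.range i, x l| ≤ 4 * B := by
  rcases hik.eq_or_lt with rfl | hlt
  · simpa using hB
  set j := i / m with hj
  have hji : j * m ≤ i := Nat.div_mul_le_self i m
  have hij : i < j * m + m := by
    have := Nat.lt_div_mul_add (a := i) hm
    omega
  have hjJ : j < J := by
    by_contra hcon
    have : J * m ≤ j * m := Nat.mul_le_mul_right m (not_lt.1 hcon)
    omega
  rcases le_or_gt k (j * m + m) with hk | hk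
  · have := abs_sum_sub_sum_le_of_reflWalk (h1 j hjJ) (h2 j hjJ) hji hij.le (hji.trans hik) hk
    linarith
  · have hj1 : j + 1 < J := by
      by_contra hcon
      have : J * m ≤ (j + 1) * m := Nat.mul_le_mul_right m (not_lt.1 hcon)
      rw [add_mul, one_mul] at this
      omega
    have e1 := abs_sum_sub_sum_le_of_reflWalk (h1 j hjJ) (h2 j hjJ) hji hij.le
      (Nat.le_add_right _ m) le_rfl
    have hs : (j + 1) * m = j * m + m := by ring
    have e2 := abs_sum_sub_sum_le_of_reflWalk (h1 _ hj1) (h2 _ hj1) (i := j * m + m) (k := k)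
      hs.le (by omega) (by omega) (by omega)
    rw [abs_le] at *
    constructor <;> linarith [e1.1, e1.2, e2.1, e2.2]

theorem interpSum_eq_convex (x : ℕ → ℝ) {s : ℝ} (hs : 0 ≤ s) :
    ∃ a : ℝ, 0 ≤ a ∧ a ≤ 1 ∧ interpSum x s =
      (1 - a) * ∑ i ∈ Finset.range ⌊s⌋₊, x i + a * ∑ i ∈ Finset.range (⌊s⌋₊ + 1), x i := by
  refine ⟨s - ⌊s⌋₊, by linarith [Nat.floor_le hs], by linarith [Nat.lt_floor_add_one s], ?_⟩
  rw [interpSum, Finset.sum_range_succ]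
  ring

/-- Each interpolated value is a convex combination of two neighbouring partial sums, so the four
differences of endpoints suffice. The extra 1 in the window length pays for rounding. -/
theorem abs_interpSum_sub_le_of_abs_sum_sub_le {x : ℕ → ℝ} {N L : ℕ} {D : ℝ}
    (h : ∀ i k : ℕ, i ≤ k → k ≤ i + L → k ≤ N + 1 →
      |∑ l ∈ Finset.range k, x l - ∑ l ∈ Finset.range i, x l| ≤ D)
    {s t : ℝ} (hs : 0 ≤ s) (hst : s ≤ t) (htN : t ≤ N) (hL : t - s + 1 ≤ L) :
    |interpSum x t - interpSum x s| ≤ D := by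
  have ht := hs.trans hst
  have hpq : ⌊s⌋₊ ≤ ⌊t⌋₊ := Nat.floor_le_floor hst
  have hqN : ⌊t⌋₊ ≤ N := by simpa using Nat.floor_le_floor htN
  have hL1 : 1 ≤ L := by
    have : (1 : ℝ) ≤ L := by linarith
    exact_mod_cast this
  have hqp : ⌊t⌋₊ + 1 ≤ ⌊s⌋₊ + L := by
    have h1 := Nat.floor_le ht
    have h2 := Nat.lt_floor_add_one s
    have : (⌊t⌋₊ : ℝ) < (⌊s⌋₊ : ℝ) + L := by linarith
    have : ⌊t⌋₊ < ⌊s⌋₊ + L := by exact_mod_cast this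
    omega
  obtain ⟨a, ha0, ha1, ha⟩ := interpSum_eq_convex x hs
  obtain ⟨b, hb0, hb1, hb⟩ := interpSum_eq_convex x ht
  have e1 := h ⌊s⌋₊ ⌊t⌋₊ hpq (by omega) (by omega)
  have e2 := h ⌊s⌋₊ (⌊t⌋₊ + 1) (by omega) (by omega) (by omega)
  have e4 := h (⌊s⌋₊ + 1) (⌊t⌋₊ + 1) (by omega) (by omega) (by omega)
  -- If both times lie in the same unit interval, the two indices are in reverse order.
  have e3 : |∑ l ∈ Finset.range ⌊t⌋₊, x l - ∑ l ∈ Finset.range (⌊s⌋₊ + 1), x l| ≤ D := by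
    rcases hpq.eq_or_lt with he | hlt
    · rw [abs_sub_comm, ← he]
      exact h _ _ (by omega) (by omega) (by omega)
    · exact h _ _ (by omega) (by omega) (by omega)
  have conv : ∀ {u v w a : ℝ}, 0 ≤ a → a ≤ 1 → |u - w| ≤ D → |v - w| ≤ D →
      |(1 - a) * u + a * v - w| ≤ D := by
    intro u v w a h0 h1 hu hv
    rw [show (1 - a) * u + a * v - w = (1 - a) * (u - w) + a * (v - w) by ring]
    refine (abs_add_le _ _).trans ?_
    rw [abs_mul, abs_mul, abs_of_nonneg h0, abs_of_nonneg (sub_nonneg.2 h1)]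
    nlinarith
  rw [hb, ha, abs_sub_comm]
  refine conv ha0 ha1 ?_ ?_
  · rw [abs_sub_comm]; exact conv hb0 hb1 e1 e2
  · rw [abs_sub_comm]; exact conv hb0 hb1 e3 e4

theorem abs_interpSum_sub_le_mul {x : ℕ → ℝ} {N : ℕ} {M : ℝ} (h : ∀ i ≤ N, |x i| ≤ M)
    {s t : ℝ} (hs : 0 ≤ s) (hst : s ≤ t) (htN : t ≤ N) :
    |interpSum x t - interpSum x s| ≤ M * (t - s) := by
  have ht := hs.trans hst
  -- Unit steps interpolate to the identity, so the nonnegative weight differences add up to t - s.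
  have hone : ∀ r : ℝ, interpSum (fun _ => 1) r = r := fun r => by simp [interpSum]
  have e := hone t
  have e' := hone s
  rw [interpSum_eq_sum _ N _ ht htN] at e
  rw [interpSum_eq_sum _ N _ hs (hst.trans htN)] at e'
  rw [interpSum_eq_sum x N t ht htN, interpSum_eq_sum x N s hs (hst.trans htN),
    ← Finset.sum_sub_distrib]
  conv_rhs => rw [← e, ← e', ← Finset.sum_sub_distrib, Finset.mul_sum]
  refine (Finset.abs_sum_le_sum_abs _ _).trans (Finset.sum_le_sum fun i hi => ?_)
  have hmono : max 0 (min 1 (s - i)) ≤ max 0 (min 1 (t - i)) := by gcongr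
  rw [← sub_mul, abs_mul, abs_of_nonneg (sub_nonneg.2 hmono), ← sub_mul, mul_one, mul_comm]
  exact mul_le_mul_of_nonneg_right (h i (by simpa [Nat.lt_succ_iff] using hi))
    (sub_nonneg.2 hmono)

theorem polyPath_zero (x : ℕ → ℝ) (n : ℕ) : polyPath x n 0 = 0 := by
  simp [polyPath, interpSum]

theorem abs_polyPath_sub_le {x : ℕ → ℝ} {n : ℕ} (hn : 0 < n) {δ D : ℝ}
    (h : ∀ s t : ℝ, 0 ≤ s → s ≤ t → t ≤ n → t - s < n * δ → |interpSum x t - interpSum x s| ≤ D)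
    {s t : unitInterval} (hst : |(t : ℝ) - s| < δ) :
    |polyPath x n t - polyPath x n s| ≤ D / Real.sqrt n := by
  have hn' : (0 : ℝ) < n := Nat.cast_pos.2 hn
  wlog hle : (s : ℝ) ≤ t generalizing s t
  · rw [abs_sub_comm]
    exact this (by rwa [abs_sub_comm]) (le_of_not_ge hle)
  have e : polyPath x n t - polyPath x n s =
      (interpSum x (n * (t : ℝ)) - interpSum x (n * (s : ℝ))) / Real.sqrt n := by
    simp [polyPath, sub_div]
  rw [e, abs_div, abs_of_nonneg (Real.sqrt_nonneg _)]
  gcongr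
  refine h _ _ (mul_nonneg hn'.le s.2.1) (by gcongr) (mul_le_of_le_one_right hn'.le t.2.2) ?_
  rw [← mul_sub]
  exact mul_lt_mul_of_pos_left ((le_abs_self _).trans_lt hst) hn'

theorem abs_polyPath_sub_le_of_abs_le {x : ℕ → ℝ} {n : ℕ} (hn : 0 < n) {δ M : ℝ}
    (h : ∀ i ≤ n, |x i| ≤ M) {s t : unitInterval} (hst : |(t : ℝ) - s| < δ) :
    |polyPath x n t - polyPath x n s| ≤ M * (n * δ) / Real.sqrt n :=
  abs_polyPath_sub_le hn (fun _ _ hs hst' ht hδ => (abs_interpSum_sub_le_mul h hs hst' ht).trans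
    (mul_le_mul_of_nonneg_left hδ.le ((abs_nonneg _).trans (h 0 (Nat.zero_le _))))) hst

theorem modCont_le {δ D : ℝ} (hδ : 0 < δ) {f : C(unitInterval, ℝ)}
    (h : ∀ s t : unitInterval, |(t : ℝ) - s| < δ → |f t - f s| ≤ D) : modCont δ f ≤ D := by
  refine csSup_le ⟨0, 0, 0, by simpa using hδ, by simp⟩ ?_
  rintro r ⟨s, t, hst, rfl⟩
  exact h s t hst

theorem abs_sub_le_modCont {δ : ℝ} (f : C(unitInterval, ℝ)) {s t : unitInterval}
    (hst : |(t : ℝ) - s| < δ) : |f t - f s| ≤ modCont δ f := by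
  refine le_csSup ⟨2 * ‖f‖, ?_⟩ ⟨s, t, hst, rfl⟩
  rintro r ⟨s, t, -, rfl⟩
  have h1 := f.norm_coe_le_norm s
  have h2 := f.norm_coe_le_norm t
  rw [Real.norm_eq_abs] at h1 h2
  linarith [abs_sub (f t) (f s)]

theorem modCont_mono {δ δ' : ℝ} (hδ : 0 < δ) (h : δ ≤ δ') (f : C(unitInterval, ℝ)) :
    modCont δ f ≤ modCont δ' f :=
  modCont_le hδ fun _ _ hst => abs_sub_le_modCont f (hst.trans_le h)

/-! ### Compactness by Arzelà–Ascoli. -/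

theorem isCompact_setOf_abs_sub_le {δ ε : ℕ → ℝ} (hδ : ∀ k, 0 < δ k)
    (hε : Tendsto ε atTop (𝓝 0)) :
    IsCompact {f : C(unitInterval, ℝ) | f 0 = 0 ∧
      ∀ k, ∀ s t : unitInterval, |(t : ℝ) - s| < δ k → |f t - f s| ≤ ε k} := by
  set F : Set (unitInterval → ℝ) := {f | f 0 = 0 ∧
      ∀ k, ∀ s t : unitInterval, |(t : ℝ) - s| < δ k → |f t - f s| ≤ ε k} with hF
  have hequi : ∀ r > 0, ∃ d > 0, ∀ f ∈ F, ∀ s t : unitInterval, dist s t < d →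
      dist (f s) (f t) < r := by
    intro r hr
    obtain ⟨k, hk⟩ := (hε.eventually (gt_mem_nhds hr)).exists
    refine ⟨δ k, hδ k, fun f hf s t hst => ?_⟩
    rw [dist_comm, Real.dist_eq]
    refine (hf.2 k s t ?_).trans_lt hk
    rwa [dist_comm, Subtype.dist_eq, Real.dist_eq] at hst
  have hcont : ∀ f ∈ F, Continuous f := fun f hf => Metric.continuous_iff.2 fun b r hr => by
    obtain ⟨d, hd, h⟩ := hequi r hr
    exact ⟨d, hd, fun a hab => h f hf a b hab⟩
  have hclosed : IsClosed F := by
    simp only [hF, Set.ofPred_and, Set.ofPred_forall]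
    refine (isClosed_eq (continuous_apply _) continuous_const).inter
      (isClosed_iInter fun k => isClosed_iInter fun s => isClosed_iInter fun t =>
        isClosed_iInter fun _ => isClosed_le ?_ continuous_const)
    fun_prop
  -- Walk from 0 to t in N equal steps shorter than `δ 0`, each changing f by at most `ε 0`.
  have hbdd : ∃ C : ℝ, ∀ f ∈ F, ∀ t, |f t| ≤ C := by
    obtain ⟨N, hN⟩ := exists_nat_gt (1 / δ 0)
    have hN0 : (0 : ℝ) < N := (one_div_pos.2 (hδ 0)).trans hN
    refine ⟨N * ε 0, fun f hf t => ?_⟩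
    have key : ∀ j : ℕ, j ≤ N → ∀ u : unitInterval, (u : ℝ) = (j / N) * t → |f u| ≤ j * ε 0 := by
      intro j
      induction j with
      | zero =>
        intro _ u hu
        have : u = 0 := Subtype.ext (by simpa using hu)
        simp [this, hf.1]
      | succ j ih =>
        intro hj u hu
        have hjN : ((j : ℝ) / N) * t ∈ unitInterval :=
          unitInterval.mul_mem ⟨by positivity, by
            rw [div_le_one hN0]; exact_mod_cast (by omega : j ≤ N)⟩ t.2
        have h1 := ih (by omega) ⟨_, hjN⟩ rfl
        have h2 := hf.2 0 ⟨_, hjN⟩ u (by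
          simp only [hu]
          have : ((j + 1 : ℕ) / N : ℝ) * t - (j / N) * t = t / N := by push_cast; ring
          rw [this, abs_of_nonneg (div_nonneg t.2.1 hN0.le), div_lt_iff₀ hN0]
          have := (div_lt_iff₀ (hδ 0)).1 hN
          linarith [t.2.2])
        have h3 := abs_sub_abs_le_abs_sub (f u) (f ⟨_, hjN⟩)
        push_cast
        linarith
    exact key N le_rfl t (by field_simp)
  obtain ⟨C, hC⟩ := hbdd
  refine ArzelaAscoli.isCompact_of_equicontinuous _ ?_ ?_
  · have himg : ContinuousMap.toFun '' {f : C(unitInterval, ℝ) | f 0 = 0 ∧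
      ∀ k, ∀ s t : unitInterval, |(t : ℝ) - s| < δ k → |f t - f s| ≤ ε k} = F := by
      ext f
      constructor
      · rintro ⟨g, hg, rfl⟩
        exact hg
      · exact fun hf => ⟨⟨f, hcont f hf⟩, hf, rfl⟩
    rw [himg]
    refine (isCompact_univ_pi fun _ => isCompact_Icc (a := -C) (b := C)).of_isClosed_subset
      hclosed fun f hf t _ => abs_le.1 (hC f hf t)
  · refine (Metric.uniformEquicontinuous_iff.2 fun r hr => ?_).equicontinuous
    obtain ⟨d, hd, h⟩ := hequi r hr
    exact ⟨d, hd, fun s t hst f => h f.1 f.2 s t hst⟩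

/-! ### Capacity bounds for increments, moduli and compact sets. -/

namespace SubLinearExpSpace

variable {Ω : Type*} {S : SubLinearExpSpace Ω} {X : ℕ → Ω → ℝ}

theorem sq_mem {Y : Ω → ℝ} (hY : Y ∈ S.H) : (fun ω => Y ω ^ 2) ∈ S.H := by
  refine S.comp_mem_one (φ := fun x => x ^ 2) ⟨1, one_pos, 1, fun x y => ?_⟩ hY
  rw [sq_sub_sq, abs_mul, one_mul, pow_one, pow_one]
  have : |x + y| ≤ |x| + |y| := abs_add_le _ _
  simp only [Real.norm_eq_abs]
  gcongr
  linarith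

theorem max_sq_sub_mem {Y : Ω → ℝ} (hY : Y ∈ S.H) (b : ℝ) :
    (fun ω => max (Y ω ^ 2 - b) 0) ∈ S.H :=
  S.comp_mem_one (φ := fun x => max (x - b) 0)
    ((LipschitzWith.id.sub (LipschitzWith.const b)).max_const 0).isLocLip (S.sq_mem hY)

theorem E_max_sq_sub_le {Y : Ω → ℝ} (hY : Y ∈ S.H) {b s : ℝ} (hb : 0 ≤ b)
    (hs : S.E (fun ω => Y ω ^ 2) ≤ (s : EReal)) :
    S.E (fun ω => max (Y ω ^ 2 - b) 0) ≤ (s : EReal) :=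
  (S.mono _ (sq_mem hY) _ (max_sq_sub_mem hY b) fun ω =>
    max_le (by linarith) (sq_nonneg (Y ω))).trans hs

theorem IsIID.capLE_reflWalk (hX : S.IsIID X) {g : ℝ → ℝ} {L : NNReal}
    (hg : LipschitzWith L g) {c B μ s : ℝ} (hc : 0 < c) (hB : 0 < B) (hμ : 0 ≤ μ)
    (hs : 0 ≤ s) (hgc : ∀ x, |g x| ≤ c) (h1 : S.E (fun ω => g (X 0 ω)) ≤ (μ : EReal))
    (h2 : S.E (fun ω => g (X 0 ω) ^ 2) ≤ (s : EReal)) (a k : ℕ) :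
    S.CapLE {ω | B ≤ reflWalk (fun i => g (X (a + i) ω)) k}
      ((1 + (2 * μ / c + 9 * s / c ^ 2)) ^ k * (c ^ 4 / (B ^ 2 + c ^ 2) ^ 2)) := by
  refine ⟨fun ω => quartic c B (reflWalk (fun i => g (X (a + i) ω)) k), ?_, fun ω => ?_, ?_⟩
  · obtain ⟨K, hK⟩ := exists_lipschitzWith_quartic c hB
    obtain ⟨K', ρ, hρ, h⟩ := LipAdapted.reflWalk X hg a k
    simp only [h]
    exact S.comp_mem _ (fun j => X j) (fun j => hX.1 j) (fun x => quartic c B (ρ x))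
      (Or.inr (hK.comp hρ).isLocLip)
  · by_cases hω : B ≤ reflWalk (fun i => g (X (a + i) ω)) k
    · rw [Set.indicator_of_mem (by exact hω)]
      exact (quartic_eq_one hB hω).ge
    · rw [Set.indicator_of_notMem (by exact hω)]
      exact quartic_nonneg _ _ _
  · rw [← quartic_zero hB.le]
    exact hX.E_quartic_reflWalk_le hg hc hB hμ hs hgc h1 h2 a k

/-- Maximal inequality for the increments of the partial sums over at most `m` steps. -/
theorem IsIID.capLE_increment (hX : S.IsIID X) (h1 : S.E (X 0) ≤ ((0 : ℝ) : EReal))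
    (h1' : S.E (-X 0) ≤ ((0 : ℝ) : EReal)) {s : ℝ} (hs : 0 ≤ s)
    (h2 : S.E (fun ω => X 0 ω ^ 2) ≤ (s : EReal)) {c B θ : ℝ} (hc : 0 < c) (hB : 0 < B)
    (hθ : S.E (fun ω => max (X 0 ω ^ 2 - c ^ 2 / 4) 0) ≤ (θ : EReal)) {m J N : ℕ} (hm : 0 < m)
    (hN : N + 1 ≤ J * m) :
    S.CapLE {ω | ¬ ∀ i k : ℕ, i ≤ k → k ≤ i + m → k ≤ N + 1 →
        |∑ l ∈ Finset.range k, X l ω - ∑ l ∈ Finset.range i, X l ω| ≤ 4 * B}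
      ((N + 1) * (4 / c ^ 2 * θ) +
        J * (2 * ((1 + 10 * s / c ^ 2) ^ m * (c ^ 4 / (B ^ 2 + c ^ 2) ^ 2)))) := by
  have hg := lipschitzWith_truncAt c
  have hgc := abs_truncAt_le hc.le
  have hg' : LipschitzWith 1 (fun x => -truncAt c x) := hg.neg
  have hgc' : ∀ x, |-truncAt c x| ≤ c := fun x => by rw [abs_neg]; exact hgc x
  have hμ : 0 ≤ (2 * c)⁻¹ * s := by positivity
  have hci : (0 : ℝ) ≤ (2 * c)⁻¹ := by positivity
  have hX2 := sq_mem (hX.1 0)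
  have hm2 := S.H.smul_mem (2 * c)⁻¹ hX2
  have m1 : S.E (fun ω => truncAt c (X 0 ω)) ≤ (((2 * c)⁻¹ * s : ℝ) : EReal) := by
    rw [← zero_add ((2 * c)⁻¹ * s)]
    refine (S.mono _ (S.H.add_mem (hX.1 0) hm2) _ (S.comp_mem_one hg.isLocLip (hX.1 0))
      fun ω => ?_).trans (E_add_le (hX.1 0) hm2 h1 (E_smul_le hX2 hci h2))
    have := (abs_le.1 (abs_truncAt_sub_le hc (X 0 ω))).2
    simp only [Pi.add_apply, Pi.smul_apply, smul_eq_mul]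
    linarith
  have m1' : S.E (fun ω => -truncAt c (X 0 ω)) ≤ (((2 * c)⁻¹ * s : ℝ) : EReal) := by
    rw [← zero_add ((2 * c)⁻¹ * s)]
    refine (S.mono _ (S.H.add_mem (S.H.neg_mem (hX.1 0)) hm2) _
      (S.comp_mem_one hg'.isLocLip (hX.1 0)) fun ω => ?_).trans
      (E_add_le (S.H.neg_mem (hX.1 0)) hm2 h1' (E_smul_le hX2 hci h2))
    have := (abs_le.1 (abs_truncAt_sub_le hc (X 0 ω))).1
    simp only [Pi.add_apply, Pi.smul_apply, Pi.neg_apply, smul_eq_mul]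
    linarith
  have m2 : S.E (fun ω => truncAt c (X 0 ω) ^ 2) ≤ (s : EReal) :=
    (S.mono _ hX2 _ (sq_mem (S.comp_mem_one hg.isLocLip (hX.1 0))) fun ω =>
      truncAt_sq_le hc.le _).trans h2
  have m2' : S.E (fun ω => (-truncAt c (X 0 ω)) ^ 2) ≤ (s : EReal) := by simpa using m2
  -- The drift s/(2c) contributes s/c² and the second moment 9s/c².
  have hκ : 2 * ((2 * c)⁻¹ * s) / c + 9 * s / c ^ 2 = 10 * s / c ^ 2 := by
    field_simp
    ring
  have hR := hX.capLE_reflWalk hg hc hB hμ hs hgc m1 m2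
  have hR' := hX.capLE_reflWalk hg' hc hB hμ hs hgc' m1' m2'
  rw [hκ] at hR hR'
  have hU := (CapLE.biUnion (Finset.range (N + 1)) fun i _ =>
    hX.capLE_abs_gt hc hθ (max_sq_sub_mem (hX.1 0) _) i).union
    (CapLE.biUnion (Finset.range J) fun j _ => (hR (j * m) m).union (hR' (j * m) m))
  refine hU.mono ?_ (le_of_eq ?_)
  · intro ω hω
    contrapose hω
    simp only [Set.mem_union, Set.mem_iUnion, Finset.mem_range, Set.mem_ofPred_eq, not_or,
      not_exists, not_lt, not_le] at hω
    obtain ⟨hω1, hω2⟩ := hω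
    simp only [Set.mem_ofPred_eq, not_not]
    intro i k hik hkm hkN
    -- Where no step exceeds c, truncation changes none of the sums.
    have hsum : ∀ j ≤ N + 1, ∑ l ∈ Finset.range j, X l ω =
        ∑ l ∈ Finset.range j, truncAt c (X l ω) := fun j hj =>
      Finset.sum_congr rfl fun l hl => (truncAt_eq_self (hω1 l (by
        have := Finset.mem_range.1 hl; omega))).symm
    rw [hsum k hkN, hsum i (hik.trans hkN)]
    exact abs_sum_sub_sum_le_of_blocks (x := fun l => truncAt c (X l ω)) hm hB.le
      (fun j hj => (hω2 j hj).1.le) (fun j hj => (hω2 j hj).2.le) hik hkm (hkN.trans hN)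
  · rw [Finset.sum_const, Finset.sum_const, Finset.card_range, Finset.card_range, nsmul_eq_mul,
      nsmul_eq_mul]
    push_cast
    ring

/-- Chebyshev and a union bound for a fixed n; the summand 1 in the witness gives M ≤ M². -/
theorem IsIID.exists_capLE_abs_gt (hX : S.IsIID X) {s : ℝ} (hs : 0 ≤ s)
    (h2 : S.E (fun ω => X 0 ω ^ 2) ≤ (s : EReal)) (n : ℕ) {η : ℝ} (hη : 0 < η) :
    ∃ M : ℝ, 0 < M ∧ S.CapLE {ω | ¬ ∀ i ≤ n, |X i ω| ≤ M} η := by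
  have h0 : 0 ≤ (n + 1) * (4 * s) / η := by positivity
  refine ⟨(n + 1) * (4 * s) / η + 1, by positivity, ?_⟩
  set M := (n + 1) * (4 * s) / η + 1 with hM
  have hM0 : 0 < M := by positivity
  refine (CapLE.biUnion (Finset.range (n + 1)) fun i _ => hX.capLE_abs_gt hM0
    (E_max_sq_sub_le (hX.1 0) (by positivity) h2) (max_sq_sub_mem (hX.1 0) _) i).mono ?_ ?_
  · intro ω hω
    simp only [Set.mem_ofPred_eq, not_forall, not_le] at hω
    obtain ⟨i, hi, h⟩ := hω
    exact Set.mem_biUnion (Finset.mem_coe.2 (Finset.mem_range.2 (Nat.lt_succ_of_le hi))) h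
  · rw [Finset.sum_const, Finset.card_range, nsmul_eq_mul]
    have h3 : (n + 1) * (4 * s) ≤ M * η := by
      have := div_mul_cancel₀ ((n + 1) * (4 * s)) hη.ne'
      rw [hM, add_mul _ 1 η, this]; linarith
    have h4 : M * η ≤ M ^ 2 * η := by
      have : M ≤ M ^ 2 := by nlinarith
      gcongr
    push_cast
    rw [div_mul_eq_mul_div, ← mul_div_assoc, div_le_iff₀ (by positivity)]
    linarith

theorem IsIID.exists_capLE_modCont_of_large (hX : S.IsIID X)
    (h1 : S.E (X 0) ≤ ((0 : ℝ) : EReal))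
    (h1' : S.E (-X 0) ≤ ((0 : ℝ) : EReal)) {s : ℝ} (hs : 0 ≤ s)
    (h2 : S.E (fun ω => X 0 ω ^ 2) ≤ (s : EReal))
    (hUI : Tendsto (fun b : ℝ => S.E (fun ω => max (X 0 ω ^ 2 - b) 0)) atTop (𝓝 0))
    {ε η : ℝ} (hε : 0 < ε) (hη : 0 < η) :
    ∃ δ : ℝ, 0 < δ ∧ ∃ n₀ : ℕ, ∀ n ≥ n₀,
      S.CapLE {ω | ε ≤ modCont δ (polyPath (fun i => X i ω) n)} η := by
  -- 32768 = 2 · 2 · 4096 · 2: at most 2/δ blocks, two signs, 64² from B² = ε²n/64, and a target of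
  -- η/2.
  set δ := min 1 (η * ε ^ 4 / (32768 * Real.exp (20 * s))) with hδ
  have hδ0 : 0 < δ := by positivity
  have hδ1 : δ ≤ 1 := min_le_left _ _
  have hδ2 : δ * (32768 * Real.exp (20 * s)) ≤ η * ε ^ 4 := by
    rw [← le_div_iff₀ (by positivity)]
    exact min_le_right _ _
  -- This tail size makes the n + 1 truncation errors total (n + 1)η/(4n) ≤ η/2.
  have hθ0 : (0 : EReal) < ((η * δ / 16 : ℝ) : EReal) := EReal.coe_pos.2 (by positivity)
  have hlim : Tendsto (fun n : ℕ => δ * n / 4) atTop atTop :=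
    (tendsto_natCast_atTop_atTop.const_mul_atTop hδ0).atTop_div_const (by norm_num)
  have hev := (hlim.eventually (hUI.eventually (gt_mem_nhds hθ0))).and
    ((hlim.eventually_ge_atTop 1).and (eventually_gt_atTop 0))
  obtain ⟨n₀, hn₀⟩ := eventually_atTop.1 hev
  refine ⟨δ, hδ0, n₀, fun n hn => ?_⟩
  obtain ⟨hθ, hn1, hn0⟩ := hn₀ n hn
  have hn' : (0 : ℝ) < n := Nat.cast_pos.2 hn0
  have hn1' : (1 : ℝ) ≤ n := by exact_mod_cast hn0
  have hδn : 0 < δ * n := by positivity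
  set c := Real.sqrt (δ * n) with hcdef
  have hc : 0 < c := Real.sqrt_pos.2 hδn
  have hc2 : c ^ 2 = δ * n := Real.sq_sqrt hδn.le
  have hq : 0 < Real.sqrt n := Real.sqrt_pos.2 hn'
  have hq2 : Real.sqrt n ^ 2 = n := Real.sq_sqrt hn'.le
  -- Then 4B/√n = ε/2, strictly below ε.
  set B := ε * Real.sqrt n / 8 with hBdef
  have hB : 0 < B := by positivity
  have hB2 : B ^ 2 = ε ^ 2 * n / 64 := by rw [hBdef, div_pow, mul_pow, hq2]; norm_num
  -- Long enough for a window of length δn plus the rounding unit, yet at most 2δn because δn ≥ 4.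
  set m := ⌊δ * n⌋₊ + 2 with hmdef
  set J := ⌊1 / δ⌋₊ + 1 with hJdef
  have hm_ge : δ * n + 1 ≤ m := by
    have := (Nat.lt_floor_add_one (δ * n)).le
    rw [hmdef]; push_cast; linarith
  have hm_le : (m : ℝ) ≤ 2 * (δ * n) := by
    have := Nat.floor_le hδn.le
    rw [hmdef]; push_cast; linarith
  have hJ_ge : 1 / δ ≤ J := by
    have := (Nat.lt_floor_add_one (1 / δ)).le
    rw [hJdef]; push_cast; linarith
  have h1δ : 1 ≤ 1 / δ := by rw [le_div_iff₀ hδ0]; linarith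
  have hJ_le : (J : ℝ) ≤ 2 * (1 / δ) := by
    have := Nat.floor_le (by positivity : 0 ≤ 1 / δ)
    rw [hJdef]; push_cast; linarith
  have hNJ : n + 1 ≤ J * m := by
    have : (n : ℝ) + 1 ≤ J * m := by
      calc (n : ℝ) + 1 ≤ (1 / δ) * (δ * n + 1) := by
            rw [mul_add, ← mul_assoc, one_div_mul_cancel hδ0.ne']; linarith
        _ ≤ J * m := by gcongr
    exact_mod_cast this
  have key := hX.capLE_increment h1 h1' hs h2 hc hB (θ := η * δ / 16)
    (by rw [hc2]; exact hθ.le) (m := m) (by omega) hNJ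
  refine key.mono ?_ ?_
  · intro ω hω hcon
    have hmod : modCont δ (polyPath (fun i => X i ω) n) ≤ 4 * B / Real.sqrt n :=
      modCont_le hδ0 fun s t hst => abs_polyPath_sub_le hn0 (fun s t hs hst' ht hlt =>
        abs_interpSum_sub_le_of_abs_sum_sub_le hcon hs hst' ht (by linarith)) hst
    have : 4 * B / Real.sqrt n = ε / 2 := by
      rw [hBdef]; field_simp; norm_num
    rw [this] at hmod
    have hω' : ε ≤ modCont δ (polyPath (fun i => X i ω) n) := hω
    linarith
  · have hexp : (1 + 10 * s / c ^ 2) ^ m ≤ Real.exp (20 * s) := by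
      have h3 : 1 + 10 * s / c ^ 2 ≤ Real.exp (10 * s / c ^ 2) := by
        linarith [Real.add_one_le_exp (10 * s / c ^ 2)]
      refine (pow_le_pow_left₀ (by positivity) h3 m).trans ?_
      rw [← Real.exp_nat_mul, Real.exp_le_exp, hc2, ← mul_div_assoc, div_le_iff₀ hδn]
      nlinarith
    have hfrac : c ^ 4 / (B ^ 2 + c ^ 2) ^ 2 ≤ 4096 * δ ^ 2 / ε ^ 4 := by
      have : c ^ 4 / (B ^ 2 + c ^ 2) ^ 2 ≤ (c ^ 2) ^ 2 / (B ^ 2) ^ 2 := by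
        rw [← pow_mul]
        gcongr
        linarith [sq_nonneg c]
      refine this.trans (le_of_eq ?_)
      rw [hc2, hB2]
      field_simp
      norm_num
    have t1 : (n + 1) * (4 / c ^ 2 * (η * δ / 16)) ≤ η / 2 := by
      rw [hc2, show ((n : ℝ) + 1) * (4 / (δ * n) * (η * δ / 16)) = (n + 1) * η / (4 * n) by
        field_simp; norm_num, div_le_div_iff₀ (by positivity) (by positivity)]
      nlinarith
    have t2 : J * (2 * ((1 + 10 * s / c ^ 2) ^ m * (c ^ 4 / (B ^ 2 + c ^ 2) ^ 2))) ≤ η / 2 := by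
      calc _ ≤ 2 * (1 / δ) * (2 * (Real.exp (20 * s) * (4096 * δ ^ 2 / ε ^ 4))) := by gcongr
        _ = δ * (32768 * Real.exp (20 * s)) / (2 * ε ^ 4) := by field_simp; norm_num
        _ ≤ η * ε ^ 4 / (2 * ε ^ 4) := by gcongr
        _ = η / 2 := by field_simp
    linarith

/-- For fixed n the path has Lipschitz constant M√n off a set of small capacity. -/
theorem IsIID.exists_capLE_modCont_single (hX : S.IsIID X) {s : ℝ} (hs : 0 ≤ s)
    (h2 : S.E (fun ω => X 0 ω ^ 2) ≤ (s : EReal)) {n : ℕ} (hn : 0 < n)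
    {ε η : ℝ} (hε : 0 < ε) (hη : 0 < η) :
    ∃ δ : ℝ, 0 < δ ∧ S.CapLE {ω | ε ≤ modCont δ (polyPath (fun i => X i ω) n)} η := by
  obtain ⟨M, hM, hcap⟩ := hX.exists_capLE_abs_gt hs h2 n hη
  have hn' : (0 : ℝ) < n := Nat.cast_pos.2 hn
  have hq : 0 < Real.sqrt n := Real.sqrt_pos.2 hn'
  have hδ : 0 < ε * Real.sqrt n / (2 * M * n) := by positivity
  refine ⟨_, hδ, hcap.mono (fun ω hω hcon => ?_) le_rfl⟩
  have h : modCont _ (polyPath (fun i => X i ω) n) ≤ _ := modCont_le hδ fun s t hst =>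
    abs_polyPath_sub_le_of_abs_le hn (x := fun i => X i ω) hcon hst
  have e : M * (n * (ε * Real.sqrt n / (2 * M * n))) / Real.sqrt n = ε / 2 := by
    field_simp
  rw [e] at h
  have hω' : ε ≤ modCont _ (polyPath (fun i => X i ω) n) := hω
  linarith

theorem IsIID.exists_capLE_modCont (hX : S.IsIID X) (h1 : S.E (X 0) ≤ ((0 : ℝ) : EReal))
    (h1' : S.E (-X 0) ≤ ((0 : ℝ) : EReal)) {s : ℝ} (hs : 0 ≤ s)
    (h2 : S.E (fun ω => X 0 ω ^ 2) ≤ (s : EReal))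
    (hUI : Tendsto (fun b : ℝ => S.E (fun ω => max (X 0 ω ^ 2 - b) 0)) atTop (𝓝 0))
    {ε η : ℝ} (hε : 0 < ε) (hη : 0 < η) :
    ∃ δ₀ : ℝ, 0 < δ₀ ∧ ∀ δ : ℝ, 0 < δ → δ ≤ δ₀ → ∀ n : ℕ, 0 < n →
      S.CapLE {ω | ε ≤ modCont δ (polyPath (fun i => X i ω) n)} η := by
  obtain ⟨δ₁, hδ₁, n₀, hlarge⟩ := hX.exists_capLE_modCont_of_large h1 h1' hs h2 hUI hε hη
  have hshrink : ∀ {δ δ' : ℝ} {n : ℕ}, 0 < δ → δ ≤ δ' →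
      S.CapLE {ω | ε ≤ modCont δ' (polyPath (fun i => X i ω) n)} η →
      S.CapLE {ω | ε ≤ modCont δ (polyPath (fun i => X i ω) n)} η := fun h0 h h' =>
    h'.mono (fun ω hω => le_trans hω (modCont_mono h0 h _)) le_rfl
  have hsmall : ∀ N : ℕ, ∃ δ₂ : ℝ, 0 < δ₂ ∧ ∀ n < N, 0 < n →
      S.CapLE {ω | ε ≤ modCont δ₂ (polyPath (fun i => X i ω) n)} η := by
    intro N
    induction N with
    | zero => exact ⟨1, one_pos, fun n hn => absurd hn (Nat.not_lt_zero n)⟩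
    | succ N ih =>
      obtain ⟨δ₂, hδ₂, h⟩ := ih
      rcases Nat.eq_zero_or_pos N with rfl | hN
      · exact ⟨1, one_pos, fun n hn hn' => by omega⟩
      obtain ⟨δ₃, hδ₃, h'⟩ := hX.exists_capLE_modCont_single hs h2 hN hε hη
      refine ⟨min δ₂ δ₃, lt_min hδ₂ hδ₃, fun n hn hn' => ?_⟩
      rcases (Nat.lt_succ_iff.1 hn).eq_or_lt with rfl | hlt
      · exact hshrink (lt_min hδ₂ hδ₃) (min_le_right _ _) h'
      · exact hshrink (lt_min hδ₂ hδ₃) (min_le_left _ _) (h n hlt hn')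
  obtain ⟨δ₂, hδ₂, hsm⟩ := hsmall n₀
  refine ⟨min δ₁ δ₂, lt_min hδ₁ hδ₂, fun δ hδ hle n hn => ?_⟩
  rcases lt_or_ge n n₀ with h | h
  · exact hshrink hδ (hle.trans (min_le_right _ _)) (hsm n h hn)
  · exact hshrink hδ (hle.trans (min_le_left _ _)) (hlarge n h)

theorem IsIID.exists_isCompact_capLE (hX : S.IsIID X) (h1 : S.E (X 0) ≤ ((0 : ℝ) : EReal))
    (h1' : S.E (-X 0) ≤ ((0 : ℝ) : EReal)) {s : ℝ} (hs : 0 ≤ s)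
    (h2 : S.E (fun ω => X 0 ω ^ 2) ≤ (s : EReal))
    (hUI : Tendsto (fun b : ℝ => S.E (fun ω => max (X 0 ω ^ 2 - b) 0)) atTop (𝓝 0))
    {η : ℝ} (hη : 0 < η) :
    ∃ K : Set C(unitInterval, ℝ), IsCompact K ∧ ∀ n : ℕ, 0 < n →
      S.CapLE {ω | polyPath (fun i => X i ω) n ∉ K} η := by
  -- The quadratic bound on δ lets a fixed Lipschitz constant beat 1/(k + 1) for large k; the
  -- capacities sum to at most η/2.
  have hex : ∀ k : ℕ, ∃ δ : ℝ, 0 < δ ∧ δ ≤ (1 / ((k : ℝ) + 1)) ^ 2 ∧ ∀ n : ℕ, 0 < n →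
      S.CapLE {ω | 1 / ((k : ℝ) + 1) ≤ modCont δ (polyPath (fun i => X i ω) n)}
        (η / 2 / 2 / 2 ^ k) := by
    intro k
    obtain ⟨δ₀, hδ₀, h⟩ := hX.exists_capLE_modCont h1 h1' hs h2 hUI
      (ε := 1 / ((k : ℝ) + 1)) (η := η / 2 / 2 / 2 ^ k) (by positivity) (by positivity)
    exact ⟨min δ₀ ((1 / ((k : ℝ) + 1)) ^ 2), by positivity, min_le_right _ _,
      h _ (by positivity) (min_le_left _ _)⟩
  choose δ hδ0 hδ hcap using hex
  refine ⟨_, isCompact_setOf_abs_sub_le hδ0 tendsto_one_div_add_atTop_nhds_zero_nat,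
    fun n hn => ?_⟩
  obtain ⟨M, hM, hcapM⟩ := hX.exists_capLE_abs_gt hs h2 n (half_pos hη)
  have hn' : (0 : ℝ) < n := Nat.cast_pos.2 hn
  have hq : 0 < Real.sqrt n := Real.sqrt_pos.2 hn'
  -- Past `k₀`, which may depend on n, the Lipschitz bound M√n alone gives the modulus conditions; K
  -- itself does not depend on n.
  obtain ⟨k₀, hk₀⟩ := exists_nat_gt (M * n / Real.sqrt n)
  refine (hcapM.union (CapLE.biUnion (Finset.range k₀) fun k _ => hcap k n hn)).mono ?_ ?_
  · intro ω hω
    contrapose hω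
    simp only [Set.mem_union, Set.mem_iUnion, Finset.mem_range, Set.mem_ofPred_eq, not_or,
      not_exists, not_not, not_le] at hω
    obtain ⟨hω1, hω2⟩ := hω
    simp only [Set.mem_ofPred_eq, not_not]
    refine ⟨polyPath_zero _ n, fun k s t hst => ?_⟩
    rcases lt_or_ge k k₀ with hk | hk
    · exact (abs_sub_le_modCont _ hst).trans (hω2 k hk).le
    · refine (abs_polyPath_sub_le_of_abs_le hn hω1 hst).trans ?_
      have hk' : M * n / Real.sqrt n ≤ k + 1 := by
        have : (k₀ : ℝ) ≤ k := by exact_mod_cast hk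
        linarith
      calc M * (n * δ k) / Real.sqrt n = (M * n / Real.sqrt n) * δ k := by ring
        _ ≤ (k + 1) * (1 / ((k : ℝ) + 1)) ^ 2 :=
          mul_le_mul hk' (hδ k) (hδ0 k).le (by positivity)
        _ = 1 / ((k : ℝ) + 1) := by field_simp
  · have : ∑ k ∈ Finset.range k₀, η / 2 / 2 / 2 ^ k ≤ η / 2 := by
      have h := (summable_geometric_two' (η / 2)).sum_le_tsum (Finset.range k₀)
        (fun i _ => by positivity)
      rwa [tsum_geometric_two'] at h
    linarith

end SubLinearExpSpace

theorem theorem5p1 {Ω : Type*} (S : SubLinearExpSpace Ω) (X : ℕ → Ω → ℝ)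
    (hX : S.IsIID X)
    (hmean : S.E (X 0) = 0) (hmean' : S.conj (X 0) = 0)
    (σlow σup : ℝ) (hσ : 0 ≤ σlow ∧ σlow ≤ σup)
    (hvar : S.E (fun ω => X 0 ω ^ 2) = ((σup ^ 2 : ℝ) : EReal))
    (hvar' : S.conj (fun ω => X 0 ω ^ 2) = ((σlow ^ 2 : ℝ) : EReal))
    (hUI : Tendsto (fun b : ℝ => S.E (fun ω => max (X 0 ω ^ 2 - b) 0)) atTop (𝓝 0)) :
    (∀ ε : ℝ, 0 < ε →
      Tendsto (fun δ : ℝ => ⨆ n : ℕ+,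
        S.cap {ω | ε ≤ modCont δ (polyPath (fun i => X i ω) (n : ℕ))}) (𝓝[>] 0) (𝓝 0)) ∧
    (∀ η : ℝ, 0 < η → ∃ K : Set C(unitInterval, ℝ), IsCompact K ∧
      (⨆ n : ℕ+, S.cap {ω | polyPath (fun i => X i ω) (n : ℕ) ∉ K}) < (η : EReal)) := by
  have h1 : S.E (X 0) ≤ ((0 : ℝ) : EReal) := hmean.le
  have h1' : S.E (-X 0) ≤ ((0 : ℝ) : EReal) := by
    rw [SubLinearExpSpace.conj, EReal.neg_eq_zero_iff] at hmean'
    exact hmean'.le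
  refine ⟨fun ε hε => ?_, fun η hη => ?_⟩
  · refine tendsto_order.2 ⟨fun a ha => Eventually.of_forall fun δ => ha.trans_le ?_,
      fun a ha => ?_⟩
    · exact (SubLinearExpSpace.cap_nonneg _).trans (le_iSup (fun n : ℕ+ =>
        S.cap {ω | ε ≤ modCont δ (polyPath (fun i => X i ω) (n : ℕ))}) 1)
    · obtain ⟨η, hη, hηa⟩ := EReal.lt_iff_exists_real_btwn.1 ha
      obtain ⟨δ₀, hδ₀, h⟩ := hX.exists_capLE_modCont h1 h1' (sq_nonneg σup) hvar.le hUI hε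
        (EReal.coe_pos.1 hη)
      filter_upwards [Ioc_mem_nhdsGT hδ₀] with δ hδ
      exact (iSup_le fun n : ℕ+ => (h δ hδ.1 hδ.2 n n.pos).cap_le).trans_lt hηa
  · obtain ⟨K, hK, h⟩ := hX.exists_isCompact_capLE h1 h1' (sq_nonneg σup) hvar.le hUI
      (half_pos hη)
    refine ⟨K, hK, (iSup_le fun n : ℕ+ => (h n n.pos).cap_le).trans_lt ?_⟩
    exact EReal.coe_lt_coe_iff.2 (half_lt_self hη)
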